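/- Let $p$ be a prime number, let $\mathbb F$ be an algebraic closure of $\mathbb F_p$, let $H=\mathbb F((t^{\mathbb Q}))$ be the Hahn field of generalized power series with well-ordered support in $\mathbb Q$ and coefficients in $\mathbb F$, and let $K=\bigcup_{N\ge 1}\mathbb F((t^{1/N}))\subset H$ be the Newton–Puiseux field. Let $v\colon H\to\mathbb Q\cup\{\infty\}$ be the valuation $v(h)=\min(\operatorname{supp}(h))$, $v(0)=\infty$, and let $\overline K\subset H$ be the algebraic closure of $K$ in $H$. For $b\in\overline K$ let $\deg_K b$ be the degree of its minimal polynomial over $K$. For $(a,\delta)\in\overline K\times\mathbb Q$ put $$B_\delta(a)=\{b\in\overline K\mid v(b-a)\ge\delta\},\qquad \deg_K B_\delta(a)=\min\{\deg_K b\mid b\in B_\delta(a)\},$$ and call $(a,\delta)$ a minimal pair if $\deg_K B_\delta(a)=\deg_K a$. Define $$s_n=\sum_{j\ge n}\binom jn t^{-1/p^{j+1}}\quad(n\ge 0),\qquad s=\sum_{n\ge0}t^ns_n\in H,$$ $$S=\Big\{(n,i)\in\mathbb Z^2\ \Big|\ 0\le n\le i,\ p\nmid\binom in\Big\},\qquad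 \delta(n,i)=n-\frac1{p^{i+1}},$$ and for $(n,i)\in S$ let $s_{n,i}$ be the truncation of $s$ that consists of all its terms with exponent $<\delta(n,i)$; that is, $$s_{n,i}=\sum_{m=0}^{n-1}t^ms_m+t^n\sum_{j=n}^{i-1}\binom jn t^{-1/p^{j+1}}.$$ Then, for every $(n,i)\in S$, the element $s_{n,i}$ is algebraic over $K$, and the pair $(s_{n,i},\delta(n,i))$ is a minimal pair; more precisely, $$\deg_K B_{\delta(n,i)}(s_{n,i})=\deg_K s_{n,i}=p^n.$$ -/

import Mathlib

noncomputable section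

namespace MinPair

/-- The Hahn field `H = F((t^ℚ))` of generalized power series with well-ordered support in `ℚ`. -/
abbrev Hahn (F : Type*) [Field F] : Type _ := HahnSeries ℚ F

/-- The embedding `F((t)) → F((t^ℚ))` which sends `∑ a_k t^k` to `∑ a_k t^(k/N)`, for `N ≥ 1`.
Its range is the field `F((t^(1/N)))`. -/
def ramify (F : Type*) [Field F] (N : ℕ+) : LaurentSeries F →+* Hahn F :=
  HahnSeries.embDomainRingHom
    ((AddMonoidHom.mulRight ((N : ℚ)⁻¹)).comp (Int.castAddHom ℚ))
    (fun a b h => by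
      have hN : ((N : ℚ)⁻¹) ≠ 0 := inv_ne_zero (by exact_mod_cast N.pos.ne')
      simpa [hN] using h)
    (fun a b => by
      have hN : (0 : ℚ) < (N : ℚ)⁻¹ := inv_pos.mpr (by exact_mod_cast N.pos)
      simp)

/-- `F((t^(1/N)))` consists of the generalized power series with support in `(1/N)ℤ`. -/
theorem mem_range_ramify {F : Type*} [Field F] (N : ℕ+) (s : Hahn F) :
    s ∈ (ramify F N).fieldRange ↔ ∀ q ∈ s.support, ∃ k : ℤ, q = k * (N : ℚ)⁻¹ := by
  have hN : (0 : ℚ) < (N : ℚ)⁻¹ := inv_pos.mpr (by exact_mod_cast N.pos)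
  constructor
  · rintro ⟨y, rfl⟩ q hq
    obtain ⟨k, -, hk⟩ := HahnSeries.support_embDomain_subset hq
    exact ⟨k, hk.symm⟩
  · intro h
    have hmono : ∀ a b : ℤ, (a : ℚ) * (N : ℚ)⁻¹ ≤ b * (N : ℚ)⁻¹ → a ≤ b := fun a b hab => by
      exact_mod_cast le_of_mul_le_mul_right hab hN
    let y : LaurentSeries F :=
      { coeff := fun k => s.coeff (k * (N : ℚ)⁻¹)
        isPWO_support' := by
          rw [Set.isPWO_iff_exists_monotone_subseq]
          intro f hf
          obtain ⟨g, hg⟩ := s.isPWO_support.exists_monotone_subseq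
            (f := fun n => (f n : ℚ) * (N : ℚ)⁻¹) (fun n => hf n)
          exact ⟨g, fun a b hab => hmono _ _ (hg hab)⟩ }
    refine ⟨y, ?_⟩
    ext q
    by_cases hq : ∃ k : ℤ, q = k * (N : ℚ)⁻¹
    · obtain ⟨k, rfl⟩ := hq
      exact HahnSeries.embDomain_coeff (x := y) (a := k)
    · have h0 : s.coeff q = 0 := by
        by_contra hne
        exact hq (h q hne)
      rw [h0]
      refine HahnSeries.embDomain_of_notMem_range ?_
      rintro ⟨k, hk⟩
      exact hq ⟨k, hk.symm⟩

theorem range_ramify_le {F : Type*} [Field F] {N M : ℕ+} (h : (N : ℕ) ∣ M) :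
    (ramify F N).fieldRange ≤ (ramify F M).fieldRange := by
  intro s hs
  rw [mem_range_ramify] at hs ⊢
  intro q hq
  obtain ⟨k, rfl⟩ := hs q hq
  obtain ⟨c, hc⟩ := h
  have hM : ((M : ℕ) : ℚ) ≠ 0 := by exact_mod_cast M.pos.ne'
  have hN : ((N : ℕ) : ℚ) ≠ 0 := by exact_mod_cast N.pos.ne'
  have hc' : ((M : ℕ) : ℚ) = (N : ℕ) * c := by exact_mod_cast hc
  refine ⟨k * c, ?_⟩
  have hc0 : (c : ℚ) ≠ 0 := fun h0 => hM (by rw [hc', h0, mul_zero])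
  push_cast
  rw [hc']
  field_simp

theorem exists_common {F : Type*} [Field F] {a b : Hahn F}
    (ha : ∃ N : ℕ+, a ∈ (ramify F N).fieldRange) (hb : ∃ N : ℕ+, b ∈ (ramify F N).fieldRange) :
    ∃ N : ℕ+, a ∈ (ramify F N).fieldRange ∧ b ∈ (ramify F N).fieldRange := by
  obtain ⟨N, hN⟩ := ha
  obtain ⟨M, hM⟩ := hb
  exact ⟨N * M, range_ramify_le (by simp) hN, range_ramify_le (by simp) hM⟩

/-- The Newton–Puiseux field `K = ⋃_{N ≥ 1} F((t^(1/N)))`, as a subfield of `H = F((t^ℚ))`. -/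
def puiseux (F : Type*) [Field F] : Subfield (Hahn F) where
  carrier := {s | ∃ N : ℕ+, s ∈ (ramify F N).fieldRange}
  mul_mem' ha hb := by
    obtain ⟨N, h1, h2⟩ := exists_common ha hb
    exact ⟨N, mul_mem h1 h2⟩
  one_mem' := ⟨1, one_mem _⟩
  add_mem' ha hb := by
    obtain ⟨N, h1, h2⟩ := exists_common ha hb
    exact ⟨N, add_mem h1 h2⟩
  zero_mem' := ⟨1, zero_mem _⟩
  neg_mem' ha := by
    obtain ⟨N, h⟩ := ha
    exact ⟨N, neg_mem h⟩
  inv_mem' _ ha := by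
    obtain ⟨N, h⟩ := ha
    exact ⟨N, inv_mem h⟩

/-- The valuation `v : H → ℚ ∪ {∞}`, `v(s) = min (supp s)`, `v(0) = ∞`. -/
abbrev v (F : Type*) [Field F] : AddValuation (Hahn F) (WithTop ℚ) := HahnSeries.addVal ℚ F

/-- `K̄`: the algebraic closure of `K` inside `H`, i.e. the elements of `H` algebraic over `K`. -/
abbrev Kbar (F : Type*) [Field F] : IntermediateField (puiseux F) (Hahn F) :=
  algebraicClosure (puiseux F) (Hahn F)

/-- `deg_K a`, the degree of the minimal polynomial of `a ∈ K̄` over `K`. -/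
def degK {F : Type*} [Field F] (a : Kbar F) : ℕ := (minpoly (puiseux F) a).natDegree

/-- The ultrametric ball `B_δ(a) = {b ∈ K̄ | v(b - a) ≥ δ}`. -/
def ball {F : Type*} [Field F] (δ : ℚ) (a : Kbar F) : Set (Kbar F) :=
  {b | (δ : WithTop ℚ) ≤ v F ((b : Hahn F) - (a : Hahn F))}

/-- `deg_K B = min {deg_K b | b ∈ B}` (used for balls, which are never empty). -/
def ballDegK {F : Type*} [Field F] (B : Set (Kbar F)) : ℕ := sInf (degK '' B)

/-- `(a, δ) ∈ K̄ × ℚ` is a minimal pair if `deg_K B_δ(a) = deg_K a`. -/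
def IsMinimalPair {F : Type*} [Field F] (a : Kbar F) (δ : ℚ) : Prop :=
  ballDegK (ball δ a) = degK a

/-- `δ(n, i) = n - 1 / p^(i+1)`. -/
def delta (p : ℕ) (n i : ℕ) : ℚ := n - 1 / (p : ℚ) ^ (i + 1)

/-- `S`, the pairs `(n, i)` of integers with `0 ≤ n ≤ i` and `p ∤ binom(i, n)`. -/
def S (p : ℕ) : Set (ℕ × ℕ) := {x | x.1 ≤ x.2 ∧ ¬ p ∣ x.2.choose x.1}

theorem delta_strictMono (p : ℕ) [hp : Fact p.Prime] (n : ℕ) : StrictMono (delta p n) := by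
  have hp1 : (1 : ℚ) < p := by exact_mod_cast hp.out.one_lt
  intro i j hij
  have h1 : (p : ℚ) ^ (i + 1) < (p : ℚ) ^ (j + 1) := pow_lt_pow_right₀ hp1 (by omega)
  have h2 : 1 / (p : ℚ) ^ (j + 1) < 1 / (p : ℚ) ^ (i + 1) :=
    one_div_lt_one_div_of_lt (by positivity) h1
  simp only [delta]
  linarith

theorem delta_bounds (p : ℕ) [hp : Fact p.Prime] (n i : ℕ) :
    (n : ℚ) - 1 < delta p n i ∧ delta p n i < n := by
  have hp1 : (1 : ℚ) < p := by exact_mod_cast hp.out.one_lt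
  have h1 : 1 < (p : ℚ) ^ (i + 1) := one_lt_pow₀ hp1 (by omega)
  have h2 : 1 / (p : ℚ) ^ (i + 1) < 1 := by
    rw [div_lt_one (by positivity)]
    exact h1
  have h3 : 0 < 1 / (p : ℚ) ^ (i + 1) := by positivity
  simp only [delta]
  constructor <;> linarith

theorem delta_eq_imp (p : ℕ) [Fact p.Prime] {n i m j : ℕ} (h : delta p n i = delta p m j) :
    n = m ∧ i = j := by
  have h1 := delta_bounds p n i
  have h2 := delta_bounds p m j
  have hnm : n = m := by
    have a1 : (n : ℚ) < m + 1 := by linarith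
    have a2 : (m : ℚ) < n + 1 := by linarith
    have b1 : n < m + 1 := by exact_mod_cast a1
    have b2 : m < n + 1 := by exact_mod_cast a2
    omega
  subst hnm
  exact ⟨rfl, (delta_strictMono p n).injective h⟩

theorem isPWO_range_delta (p : ℕ) [Fact p.Prime] :
    (Set.range fun x : ℕ × ℕ => delta p x.1 x.2).IsPWO := by
  have hmono : Monotone fun x : ℕ ×ₗ ℕ => delta p (ofLex x).1 (ofLex x).2 := by
    intro x y hxy
    rcases (Prod.Lex.le_iff (x := x) (y := y)).mp hxy with h | ⟨h1, h2⟩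
    · have a1 := (delta_bounds p (ofLex x).1 (ofLex x).2).2
      have a2 := (delta_bounds p (ofLex y).1 (ofLex y).2).1
      have a3 : ((ofLex x).1 : ℚ) + 1 ≤ (ofLex y).1 := by exact_mod_cast h
      show delta p _ _ ≤ delta p _ _
      linarith
    · show delta p _ _ ≤ delta p _ _
      rw [h1]
      exact (delta_strictMono p _).monotone h2
  have := (Set.isPWO_of_wellQuasiOrderedLE (Set.univ : Set (ℕ ×ₗ ℕ))).image_of_monotone hmono
  refine this.mono ?_
  rintro _ ⟨x, rfl⟩
  exact ⟨toLex x, trivial, rfl⟩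

/-- The summable family of monomials `j ↦ binom(j, n) t^(-1/p^(j+1))`.
The terms with `j < n` vanish, because then `binom(j, n) = 0`. -/
def layerFamily (p : ℕ) [Fact p.Prime] (F : Type*) [Field F] (n : ℕ) :
    HahnSeries.SummableFamily ℚ F ℕ where
  toFun j := HahnSeries.single (-1 / (p : ℚ) ^ (j + 1)) ((j.choose n : ℕ) : F)
  isPWO_iUnion_support' := by
    refine (isPWO_range_delta p).mono ?_
    refine Set.iUnion_subset fun j => HahnSeries.support_single_subset.trans ?_
    rintro _ rfl
    refine ⟨(0, j), ?_⟩
    simp only [delta, Nat.cast_zero]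
    ring
  finite_co_support' q := by
    refine Set.Subsingleton.finite fun i hi j hj => ?_
    have key : ∀ k : ℕ, (HahnSeries.single (-1 / (p : ℚ) ^ (k + 1))
        ((k.choose n : ℕ) : F)).coeff q ≠ 0 → q = delta p 0 k := fun k hk => by
      have : q = -1 / (p : ℚ) ^ (k + 1) := HahnSeries.support_single_subset hk
      rw [this]
      simp only [delta, Nat.cast_zero]
      ring
    exact (delta_eq_imp p ((key i hi).symm.trans (key j hj))).2

/-- `s_n = ∑_{j ≥ n} binom(j, n) t^(-1/p^(j+1))`. -/
def layer (p : ℕ) [Fact p.Prime] (F : Type*) [Field F] (n : ℕ) : Hahn F :=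
  (layerFamily p F n).hsum

theorem support_shift_layer (p : ℕ) [Fact p.Prime] (F : Type*) [Field F] (n : ℕ) {q : ℚ}
    (hq : (HahnSeries.single (n : ℚ) (1 : F) * layer p F n).coeff q ≠ 0) :
    ∃ j, q = delta p n j := by
  rw [HahnSeries.coeff_single_mul, one_mul, layer, HahnSeries.SummableFamily.coeff_hsum] at hq
  obtain ⟨j, hj⟩ : ∃ j, (layerFamily p F n j).coeff (q - n) ≠ 0 := by
    by_contra! hall
    exact hq (finsum_eq_zero_of_forall_eq_zero hall)
  have : q - n = -1 / (p : ℚ) ^ (j + 1) := HahnSeries.support_single_subset hj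
  refine ⟨j, ?_⟩
  simp only [delta]
  linear_combination this

/-- The summable family `n ↦ t^n s_n`. -/
def seriesFamily (p : ℕ) [Fact p.Prime] (F : Type*) [Field F] :
    HahnSeries.SummableFamily ℚ F ℕ where
  toFun n := HahnSeries.single (n : ℚ) (1 : F) * layer p F n
  isPWO_iUnion_support' := by
    refine (isPWO_range_delta p).mono (Set.iUnion_subset fun n q hq => ?_)
    obtain ⟨j, rfl⟩ := support_shift_layer p F n hq
    exact ⟨(n, j), rfl⟩
  finite_co_support' q := by
    refine Set.Subsingleton.finite fun n hn m hm => ?_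
    obtain ⟨i, hi⟩ := support_shift_layer p F n hn
    obtain ⟨j, hj⟩ := support_shift_layer p F m hm
    exact (delta_eq_imp p (hi.symm.trans hj)).1

/-- `s = ∑_{n ≥ 0} t^n s_n`. -/
def series (p : ℕ) [Fact p.Prime] (F : Type*) [Field F] : Hahn F := (seriesFamily p F).hsum

/-- `s_{n,i}`, the truncation of `s` to the exponents smaller than `δ(n, i)`. -/
def trunc (p : ℕ) [Fact p.Prime] (F : Type*) [Field F] (n i : ℕ) : Hahn F :=
  HahnSeries.truncLT (delta p n i) (series p F)

end MinPair

end

/-!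
Write `℘ x = x ^ p - x`, and let `n ≥ 1`. Pascal's rule gives `℘ s_0 = t⁻¹` and `℘ s_(m+1) = s_m`,
so `∑_{m < n} t ^ m s_m = ∑_{l < n} t ^ (n - 1 - l) ℘ˡ s_(n-1)` is the value at `s_(n-1)` of an
additive polynomial over `K`. The truncation `s_(n,i)` differs from this partial sum by an element
of `K`, and therefore lies in `K(s_(n-1))`.

The degree of `s_(n-1)` is `p ^ n`. It is a root of `℘ⁿ X = t⁻¹`, of degree `p ^ n`, and with fewer
conjugates some nontrivial `F`-linear combination of `s_0, …, s_(n-1)` would be fixed under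
conjugation and so lie in `K`. But an element of `K` has only finitely many nonzero coefficients at
the exponents `-1 / p ^ (j + 1)`, while the functions `j ↦ binom(j, m)` are linearly independent on
every tail.

The conjugates of `s_(n-1)` are translates by constants `c`, so those of the partial sum are
translates by `c t ^ (n - 1) + …`, of valuation `n - 1 < δ(n, i)` for `c ≠ 0`. Hence every `b` in
the ball is closer to the partial sum than the other conjugates are, and Krasner's lemma puts the
partial sum, and with it `s_(n-1)`, into `K(b)`. Although `K` is not complete, it is the directed
union of the complete fields `F((t^(1/N)))`, which suffices.
-/

noncomputable section

namespace MinPair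

section Krasner

open IntermediateField Polynomial

theorem map_minpoly_eq_of_coeff_mem {H : Type*} [Field H] {C K : Subfield H} (hCK : C ≤ K) {a : H}
    (ha : IsIntegral K a) (hcoeff : ∀ k, ((minpoly K a).coeff k : H) ∈ C) :
    (minpoly C a).map (algebraMap C H) = (minpoly K a).map (algebraMap K H) := by
  have hlifts : (minpoly K a).map (algebraMap K H) ∈ lifts (algebraMap C H) := by
    refine (lifts_iff_coeff_lifts _).mpr fun k ↦ ?_
    rw [coeff_map]
    exact ⟨⟨_, hcoeff k⟩, rfl⟩
  obtain ⟨Q, hQmap, hQdeg, hQmonic⟩ :=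
    lifts_and_degree_eq_and_monic hlifts ((minpoly.monic ha).map _)
  rw [← hQmap, minpoly.unique C a hQmonic]
  · rw [aeval_def, ← eval_map, hQmap, eval_map, ← aeval_def, minpoly.aeval]
  · intro q hq hqa
    rw [hQdeg, degree_map, ← degree_map q (Subfield.inclusion hCK)]
    refine minpoly.min K a (hq.map _) ?_
    rw [aeval_def, eval₂_map]
    exact hqa

theorem exists_forall_coeff_mem_of_eq_iSup {H ι : Type*} [Field H] [Nonempty ι]
    {C : ι → Subfield H} (hC : Directed (· ≤ ·) C) {K : Subfield H} (hK : K = ⨆ i, C i)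
    (P : K[X]) : ∃ i, ∀ k, (P.coeff k : H) ∈ C i := by
  classical
  have hcoeff (k : ℕ) : ∃ i, (P.coeff k : H) ∈ C i :=
    (Subfield.mem_iSup_of_directed hC).mp (hK ▸ (P.coeff k).2)
  choose i hi using hcoeff
  obtain ⟨j, hj⟩ := hC.finset_le (P.support.image i)
  refine ⟨j, fun k ↦ ?_⟩
  by_cases hk : k ∈ P.support
  · exact hj _ (Finset.mem_image_of_mem i hk) (hi k)
  · simp [notMem_support_iff.mp hk]

theorem exists_forall_map_minpoly_eq {H ι : Type*} [Field H] [Nonempty ι]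
    {C : ι → Subfield H} (hC : Directed (· ≤ ·) C) {K : Subfield H} (hK : K = ⨆ i, C i)
    {a : H} (ha : IsIntegral K a) :
    ∃ i, ∀ j, C i ≤ C j →
      (minpoly (C j) a).map (algebraMap (C j) H) = (minpoly K a).map (algebraMap K H) := by
  obtain ⟨i, hi⟩ := exists_forall_coeff_mem_of_eq_iSup hC hK (minpoly K a)
  exact ⟨i, fun j hij ↦ map_minpoly_eq_of_coeff_mem (hK ▸ le_iSup C j) ha fun k ↦ hij (hi k)⟩

theorem krasner_of_completeSpace {H : Type*} [NormedField H] [IsUltrametricDist H] {C : Subfield H}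
    [CompleteSpace C] (hnontrivial : ∃ c : C, 1 < ‖c‖) {a b : H} (ha : IsSeparable C a)
    (hsplits : ((minpoly C a).map (algebraMap C H)).Splits) (hb : IsIntegral C b)
    (hlt : ∀ a', IsConjRoot C a a' → a ≠ a' → ‖a - b‖ < ‖a - a'‖) : a ∈ C⟮b⟯ := by
  let : NontriviallyNormedField C := { non_trivial := hnontrivial }
  let L := algebraicClosure C H
  let : NormedAlgebra C L := { norm_smul_le := fun c x ↦ (norm_mul (c : H) (x : H)).le }
  have : Algebra.IsAlgebraic C L := algebraicClosure.isAlgebraic C H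
  let x : L := ⟨a, mem_algebraicClosure_iff.mpr ha.isIntegral.isAlgebraic⟩
  let y : L := ⟨b, mem_algebraicClosure_iff.mpr hb.isAlgebraic⟩
  have hx : minpoly C x = minpoly C a := (minpoly.algHom_eq L.val L.val.injective x).symm
  have hmem : x ∈ C⟮y⟯ := by
    refine IsKrasner.krasner (by rwa [hx]) ?_ (Algebra.IsIntegral.isIntegral y) fun x' hx' hne ↦ ?_
    · rw [hx]
      refine splits_of_splits hsplits fun z hz ↦ ?_
      exact mem_algebraicClosure_iff.mpr ⟨_, minpoly.ne_zero ha.isIntegral, (mem_rootSet.mp hz).2⟩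
    · exact hlt x' ((isConjRoot_algHom_iff L.val).mpr hx') (Subtype.coe_injective.ne hne)
  have hmap : (C⟮y⟯).map L.val = C⟮b⟯ := by rw [adjoin_map, Set.image_singleton]; rfl
  exact hmap ▸ ⟨x, hmem, rfl⟩

/-- Krasner's lemma descends to directed unions, because only finitely many coefficients matter. -/
theorem krasner_of_eq_iSup {H ι : Type*} [NormedField H] [IsUltrametricDist H] [Nonempty ι]
    {C : ι → Subfield H} [∀ i, CompleteSpace (C i)] (hC : Directed (· ≤ ·) C)
    (hnontrivial : ∀ i, ∃ c : C i, 1 < ‖c‖) {K : Subfield H} (hK : K = ⨆ i, C i) {a b : H}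
    (ha : IsSeparable K a) (hsplits : ((minpoly K a).map (algebraMap K H)).Splits)
    (hb : IsIntegral K b)
    (hlt : ∀ a', IsConjRoot K a a' → a ≠ a' → ‖a - b‖ < ‖a - a'‖) : a ∈ K⟮b⟯ := by
  obtain ⟨i, hi⟩ := exists_forall_map_minpoly_eq hC hK ha.isIntegral
  obtain ⟨j, hj⟩ := exists_forall_map_minpoly_eq hC hK hb
  obtain ⟨k, hik, hjk⟩ := hC i j
  have hCK : C k ≤ K := hK ▸ le_iSup C k
  have hmina := hi k hik
  have hsep : IsSeparable (C k) a := by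
    rw [IsSeparable, ← separable_map (algebraMap (C k) H), hmina, separable_map]
    exact ha
  have hintb : IsIntegral (C k) b := by
    rw [← minpoly.ne_zero_iff, ← Polynomial.map_ne_zero_iff (algebraMap (C k) H).injective,
      hj k hjk]
    exact map_ne_zero (minpoly.ne_zero hb)
  have hmem : a ∈ (C k)⟮b⟯ := by
    refine krasner_of_completeSpace (hnontrivial k) hsep (hmina ▸ hsplits) hintb fun a' ha' ↦ ?_
    refine hlt a' (isConjRoot_of_aeval_eq_zero ha.isIntegral ?_)
    rw [aeval_def, ← eval_map, ← hmina, eval_map]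
    exact ha'.aeval_eq_zero
  refine Subfield.closure_mono (Set.union_subset_union_left _ ?_) hmem
  rintro _ ⟨c, rfl⟩
  exact ⟨Subfield.inclusion hCK c, rfl⟩

end Krasner
section ArtinSchreier

open Polynomial

variable (p : ℕ) [hp : Fact p.Prime]

/-- The Artin–Schreier map `x ↦ x ^ p - x` of a commutative ring of characteristic `p`. -/
def artinSchreier (R : Type*) [CommRing R] [CharP R p] : R →+ R :=
  (frobenius R p : R →+ R) - AddMonoidHom.id R

theorem artinSchreier_apply {R : Type*} [CommRing R] [CharP R p] (x : R) :
    artinSchreier p R x = x ^ p - x := rfl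

theorem map_artinSchreier_iterate {R S : Type*} [CommRing R] [CharP R p] [CommRing S] [CharP S p]
    (f : R →+* S) (n : ℕ) (x : R) :
    f ((artinSchreier p R)^[n] x) = (artinSchreier p S)^[n] (f x) :=
  Function.Semiconj.iterate_right (f := f) (fun x ↦ by simp [artinSchreier_apply]) n x

/-- The additive polynomial which induces the `n`-th iterate of the Artin–Schreier map. -/
def artinSchreierPoly (R : Type*) [CommRing R] [CharP R p] (n : ℕ) : R[X] :=
  (artinSchreier p R[X])^[n] X

theorem artinSchreierPoly_succ (R : Type*) [CommRing R] [CharP R p] (n : ℕ) :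
    artinSchreierPoly p R (n + 1) = artinSchreierPoly p R n ^ p - artinSchreierPoly p R n := by
  rw [artinSchreierPoly, Function.iterate_succ_apply', artinSchreier_apply, artinSchreierPoly]

theorem map_artinSchreierPoly {R S : Type*} [CommRing R] [CharP R p] [CommRing S] [CharP S p]
    (f : R →+* S) (n : ℕ) : (artinSchreierPoly p R n).map f = artinSchreierPoly p S n := by
  rw [artinSchreierPoly, ← coe_mapRingHom, map_artinSchreier_iterate, coe_mapRingHom, map_X,
    artinSchreierPoly]

theorem eval_artinSchreierPoly {R : Type*} [CommRing R] [CharP R p] (n : ℕ) (x : R) :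
    (artinSchreierPoly p R n).eval x = (artinSchreier p R)^[n] x := by
  rw [artinSchreierPoly, ← coe_evalRingHom, map_artinSchreier_iterate, coe_evalRingHom, eval_X]

theorem derivative_artinSchreierPoly (R : Type*) [CommRing R] [CharP R p] (n : ℕ) :
    derivative (artinSchreierPoly p R n) = (-1) ^ n := by
  induction n with
  | zero => simp [artinSchreierPoly]
  | succ n ih => simp [artinSchreierPoly_succ, derivative_pow, ih, pow_succ]

theorem monic_artinSchreierPoly_and_natDegree_eq (R : Type*) [CommRing R] [Nontrivial R]
    [CharP R p] (n : ℕ) :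
    (artinSchreierPoly p R n).Monic ∧ (artinSchreierPoly p R n).natDegree = p ^ n := by
  induction n with
  | zero => simp [artinSchreierPoly, monic_X]
  | succ n ih =>
    obtain ⟨hmonic, hdeg⟩ := ih
    have hpow : (artinSchreierPoly p R n ^ p).natDegree = p ^ (n + 1) := by
      rw [hmonic.natDegree_pow, hdeg, pow_succ']
    have hlt : (artinSchreierPoly p R n).natDegree < (artinSchreierPoly p R n ^ p).natDegree := by
      rw [hpow, hdeg]
      exact Nat.pow_lt_pow_right hp.out.one_lt n.lt_succ_self
    rw [artinSchreierPoly_succ]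
    refine ⟨(hmonic.pow p).sub_of_left (degree_lt_degree hlt), ?_⟩
    rw [natDegree_sub_eq_left_of_natDegree_lt hlt, hpow]

theorem artinSchreierPoly_comp_X_sub_C {R : Type*} [CommRing R] [CharP R p] (n : ℕ) (x : R) :
    (artinSchreierPoly p R n).comp (X - C x) =
      artinSchreierPoly p R n - C ((artinSchreier p R)^[n] x) := by
  rw [artinSchreierPoly, ← coe_compRingHom_apply, map_artinSchreier_iterate,
    coe_compRingHom_apply, X_comp, iterate_map_sub, map_artinSchreier_iterate]

section ArtinSchreierSum

variable {R A : Type*} [CommRing R] [CommRing A] [CharP A p] [Algebra R A]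

/-- The additive map `y ↦ ∑_{l < n} T l • ℘ˡ y`, for `℘` the Artin–Schreier map. -/
def artinSchreierSum (n : ℕ) (T : ℕ → R) : A →+ A :=
  AddMonoidHom.mk' (fun y ↦ ∑ l ∈ Finset.range n, T l • (artinSchreier p A)^[l] y) fun y z ↦ by
    simp only [iterate_map_add, smul_add, Finset.sum_add_distrib]

theorem artinSchreierSum_apply (n : ℕ) (T : ℕ → R) (y : A) :
    artinSchreierSum p n T y = ∑ l ∈ Finset.range n, T l • (artinSchreier p A)^[l] y := rfl

theorem map_artinSchreierSum {B : Type*} [CommRing B] [CharP B p] [Algebra R B] (f : A →ₐ[R] B)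
    (n : ℕ) (T : ℕ → R) (y : A) :
    f (artinSchreierSum p n T y) = artinSchreierSum p n T (f y) := by
  simp only [artinSchreierSum_apply, map_sum, map_smul]
  exact Finset.sum_congr rfl fun l _ ↦
    congrArg (T l • ·) (map_artinSchreier_iterate p (f : A →+* B) l y)

theorem artinSchreierSum_algebraMap_comp {S : Type*} [CommRing S] [Algebra S R] [Algebra S A]
    [IsScalarTower S R A] (n : ℕ) (T : ℕ → S) (y : A) :
    artinSchreierSum p n (algebraMap S R ∘ T) y = artinSchreierSum p n T y := by
  simp only [artinSchreierSum_apply, Function.comp_apply, algebraMap_smul]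

theorem artinSchreierSum_mem {K M : Type*} [Field K] [Field M] [CharP M p] [Algebra K M]
    (E : IntermediateField K M) (n : ℕ) (T : ℕ → K) {y : M} (hy : y ∈ E) :
    artinSchreierSum p n T y ∈ E := by
  rw [artinSchreierSum_apply]
  refine sum_mem fun l _ ↦ E.smul_mem ?_
  clear * - hy
  induction l with
  | zero => exact hy
  | succ l ih =>
    rw [Function.iterate_succ_apply', artinSchreier_apply]
    exact sub_mem (pow_mem ih p) ih

theorem artinSchreierSum_eq_of_isConjRoot {K M : Type*} [Field K] [CharP K p] [Field M] [CharP M p]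
    [Algebra K M] {n : ℕ} {T : ℕ → K} {r : K} {s s' : M}
    (hs : artinSchreierSum p n T s = algebraMap K M r) (hconj : IsConjRoot K s s') :
    artinSchreierSum p n T s' = algebraMap K M r := by
  have haeval (y : M) : aeval y (artinSchreierSum p n T (X : K[X]) - C r) =
      artinSchreierSum p n T y - algebraMap K M r := by
    rw [map_sub, map_artinSchreierSum, aeval_X, aeval_C]
  have hdvd : minpoly K s ∣ artinSchreierSum p n T X - C r :=
    minpoly.dvd K s (by rw [haeval, hs, sub_self])
  rw [← sub_eq_zero, ← haeval]
  exact aeval_eq_zero_of_dvd_aeval_eq_zero hdvd hconj.aeval_eq_zero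

/-- The first `n` iterates of `℘` are `n` vectors in the space of additive maps `B → F`, whose
dimension over `F` is the rank of `B` over the prime field. -/
theorem exists_artinSchreierSum_eq_zero {F : Type*} [Field F] [CharP F p]
    (B : AddSubgroup F) [Finite B] {n : ℕ} (h : Nat.card B < p ^ n) :
    ∃ c : ℕ → F, (∃ l < n, c l ≠ 0) ∧ ∀ a ∈ B, artinSchreierSum p n c a = 0 := by
  let : Algebra (ZMod p) F := ZMod.algebra F p
  let V : Submodule (ZMod p) F := AddSubgroup.toZModSubmodule p B
  have : Finite V := ‹Finite B›
  have hrank : Module.finrank (ZMod p) V < n := by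
    refine (Nat.pow_lt_pow_iff_right hp.out.one_lt).mp ?_
    calc p ^ Module.finrank (ZMod p) V = Nat.card V := by
          rw [Module.natCard_eq_pow_finrank (K := ZMod p), Nat.card_zmod]
      _ < p ^ n := h
  let w : F →ₗ[ZMod p] F := (artinSchreier p F).toZModLinearMap p
  let iterates : Fin n → V →ₗ[ZMod p] F := fun l ↦ (w ^ (l : ℕ)).domRestrict V
  have hdep : ¬ LinearIndependent F iterates := fun hli ↦ by
    have hle := hli.fintype_card_le_finrank
    rw [Module.finrank_linearMap_self, Fintype.card_fin] at hle
    omega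
  obtain ⟨g, hg, i, hi⟩ := Fintype.not_linearIndependent_iff.mp hdep
  refine ⟨fun l ↦ if hl : l < n then g ⟨l, hl⟩ else 0, ⟨i, i.2, by simpa using hi⟩, fun a ha ↦ ?_⟩
  have hga := LinearMap.congr_fun hg (⟨a, ha⟩ : V)
  rw [LinearMap.sum_apply] at hga
  rw [artinSchreierSum_apply, Finset.sum_range]
  refine Eq.trans (Finset.sum_congr rfl fun l _ ↦ ?_) hga
  have hiterate : iterates l ⟨a, ha⟩ = (artinSchreier p F)^[l] a := Module.End.pow_apply w l a
  simp only [l.2, dif_pos, LinearMap.smul_apply, hiterate]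

end ArtinSchreierSum

section Field

open IntermediateField

variable {K M : Type*} [Field K] [CharP K p] [Field M] [CharP M p] [Algebra K M]
  {n : ℕ} {x : K} {s : M}

variable {p}

theorem minpoly_dvd_of_artinSchreier_iterate_eq
    (hs : (artinSchreier p M)^[n] s = algebraMap K M x) :
    minpoly K s ∣ artinSchreierPoly p K n - C x := by
  refine minpoly.dvd K s ?_
  rw [map_sub, aeval_C, aeval_def, ← eval_map, map_artinSchreierPoly, eval_artinSchreierPoly, hs,
    sub_self]

theorem isSeparable_of_artinSchreier_iterate_eq
    (hs : (artinSchreier p M)^[n] s = algebraMap K M x) : IsSeparable K s := by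
  have hunit : IsUnit (derivative (artinSchreierPoly p K n - C x)) := by
    rw [derivative_sub, derivative_C, sub_zero, derivative_artinSchreierPoly]
    exact isUnit_neg_one.pow n
  exact Separable.of_dvd (isCoprime_one_right.of_isCoprime_of_dvd_right hunit.dvd)
    (minpoly_dvd_of_artinSchreier_iterate_eq hs)

theorem natDegree_minpoly_le_of_artinSchreier_iterate_eq
    (hs : (artinSchreier p M)^[n] s = algebraMap K M x) : (minpoly K s).natDegree ≤ p ^ n := by
  obtain ⟨hmonic, hdeg⟩ := monic_artinSchreierPoly_and_natDegree_eq p K n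
  have hpos : 0 < (artinSchreierPoly p K n).degree := by
    rw [← natDegree_pos_iff_degree_pos, hdeg]
    exact pow_pos hp.out.pos n
  have hne : artinSchreierPoly p K n - C x ≠ 0 :=
    (hmonic.sub_of_left (degree_C_le.trans_lt hpos)).ne_zero
  exact (natDegree_le_of_dvd (minpoly_dvd_of_artinSchreier_iterate_eq hs) hne).trans_eq
    (natDegree_sub_C.trans hdeg)

theorem isSeparable_artinSchreierSum
    (hs : (artinSchreier p M)^[n] s = algebraMap K M x) (m : ℕ) (T : ℕ → K) :
    IsSeparable K (artinSchreierSum p m T s) :=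
  mem_separableClosure_iff.mp (artinSchreierSum_mem p (separableClosure K M) m T
    (mem_separableClosure_iff.mpr (isSeparable_of_artinSchreier_iterate_eq hs)))

variable (F : Type*) [Field F] [IsAlgClosed F] [CharP F p] [Algebra F M]

include F

theorem splits_artinSchreierPoly (n : ℕ) : (artinSchreierPoly p M n).Splits := by
  rw [← map_artinSchreierPoly p (algebraMap F M)]
  exact (IsAlgClosed.splits _).map _

theorem exists_algebraMap_eq_of_artinSchreier_iterate_eq_zero {d : M}
    (hd : (artinSchreier p M)^[n] d = 0) : ∃ c : F, algebraMap F M c = d := by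
  have hmonic := (monic_artinSchreierPoly_and_natDegree_eq p F n).1
  refine (IsAlgClosed.splits (artinSchreierPoly p F n)).mem_range_of_isRoot hmonic.ne_zero ?_
  rw [map_artinSchreierPoly, IsRoot.def, eval_artinSchreierPoly, hd]

/-- Over a field containing a root `s`, additivity turns `℘ⁿ(X) - x` into `℘ⁿ(X - s)`. -/
theorem splits_minpoly_of_artinSchreier_iterate_eq
    (hs : (artinSchreier p M)^[n] s = algebraMap K M x) :
    ((minpoly K s).map (algebraMap K M)).Splits := by
  have hfactor : (artinSchreierPoly p K n - C x).map (algebraMap K M) =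
      (artinSchreierPoly p M n).comp (X - C s) := by
    rw [artinSchreierPoly_comp_X_sub_C, hs, Polynomial.map_sub, map_artinSchreierPoly, map_C]
  have hmonic := (monic_artinSchreierPoly_and_natDegree_eq p M n).1
  refine Splits.of_dvd (hfactor ▸ (splits_artinSchreierPoly F n).comp_X_sub_C s) ?_
    (Polynomial.map_dvd _ (minpoly_dvd_of_artinSchreier_iterate_eq hs))
  exact hfactor ▸ (hmonic.comp (monic_X_sub_C s) (by simp)).ne_zero

theorem exists_eq_add_algebraMap_of_isConjRoot
    (hs : (artinSchreier p M)^[n] s = algebraMap K M x) {s' : M} (hs' : IsConjRoot K s s') :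
    ∃ c : F, s' = s + algebraMap F M c := by
  have hroot : (artinSchreier p M)^[n] s' = algebraMap K M x := by
    have h := aeval_eq_zero_of_dvd_aeval_eq_zero
      (minpoly_dvd_of_artinSchreier_iterate_eq hs) hs'.aeval_eq_zero
    rwa [map_sub, aeval_C, aeval_def, ← eval_map, map_artinSchreierPoly, eval_artinSchreierPoly,
      sub_eq_zero] at h
  obtain ⟨c, hc⟩ := exists_algebraMap_eq_of_artinSchreier_iterate_eq_zero (n := n) F
    (d := s' - s) (by rw [iterate_map_sub, hroot, hs, sub_self])
  exact ⟨c, by rw [hc, add_sub_cancel]⟩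

theorem splits_minpoly_artinSchreierSum
    (hs : (artinSchreier p M)^[n] s = algebraMap K M x) (m : ℕ) (T : ℕ → K) :
    ((minpoly K (artinSchreierSum p m T s)).map (algebraMap K M)).Splits :=
  splits_of_mem_adjoin K M
    (by
      rintro _ rfl
      exact ⟨(isSeparable_of_artinSchreier_iterate_eq hs).isIntegral,
        splits_minpoly_of_artinSchreier_iterate_eq F hs⟩)
    (artinSchreierSum_mem p K⟮s⟯ m T (mem_adjoin_simple_self K s))

theorem exists_eq_artinSchreierSum_of_isConjRoot
    (hs : (artinSchreier p M)^[n] s = algebraMap K M x) (m : ℕ) (T : ℕ → K) {a' : M}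
    (ha' : IsConjRoot K (artinSchreierSum p m T s) a') :
    ∃ c : F, IsConjRoot K s (s + algebraMap F M c) ∧
      a' = artinSchreierSum p m T (s + algebraMap F M c) := by
  have hint := (isSeparable_of_artinSchreier_iterate_eq hs).isIntegral
  have hsplits := splits_minpoly_of_artinSchreier_iterate_eq F hs
  have hmem := artinSchreierSum_mem p K⟮s⟯ m T (mem_adjoin_simple_self K s)
  obtain ⟨φ, hφ⟩ := exists_algHom_adjoin_of_splits_of_aeval
    (S := {s}) (by rintro _ rfl; exact ⟨hint, hsplits⟩) hmem ha'.aeval_eq_zero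
  have hconj : IsConjRoot K s (φ (AdjoinSimple.gen K s)) := by
    rw [isConjRoot_def, ← minpoly_gen K s]
    exact (minpoly.algHom_eq φ φ.injective _).symm
  obtain ⟨c, hc⟩ := exists_eq_add_algebraMap_of_isConjRoot F hs hconj
  refine ⟨c, hc ▸ hconj, ?_⟩
  have hgen : (⟨artinSchreierSum p m T s, hmem⟩ : K⟮s⟯) =
      artinSchreierSum p m T (AdjoinSimple.gen K s) :=
    Subtype.ext (map_artinSchreierSum p K⟮s⟯.val m T (AdjoinSimple.gen K s)).symm
  rw [← hφ, hgen, map_artinSchreierSum, hc]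

theorem mem_adjoin_artinSchreierSum
    (hs : (artinSchreier p M)^[n] s = algebraMap K M x) (m : ℕ) (T : ℕ → K)
    (hT : ∀ c : F, artinSchreierSum p m T (algebraMap F M c) = 0 → c = 0) :
    s ∈ K⟮artinSchreierSum p m T s⟯ := by
  set E := K⟮artinSchreierSum p m T s⟯
  have hsep := isSeparable_of_artinSchreier_iterate_eq hs
  by_contra hsE
  obtain ⟨s', hne, hs'⟩ := (notMem_iff_exists_ne_and_isConjRoot (K := E) (x := s)
    (hsep.tower_top E) (hsep.isIntegral.minpoly_splits_tower_top
      (splits_minpoly_of_artinSchreier_iterate_eq F hs))).mp (by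
        rintro ⟨y, hy⟩
        exact hsE (hy ▸ y.2))
  have hvalue : artinSchreierSum p m (algebraMap K E ∘ T) s =
      algebraMap E M (AdjoinSimple.gen K (artinSchreierSum p m T s)) :=
    artinSchreierSum_algebraMap_comp p m T s
  have hvalue' := artinSchreierSum_eq_of_isConjRoot p hvalue hs'
  obtain ⟨c, hs'c⟩ := exists_eq_add_algebraMap_of_isConjRoot F hs
    (hs'.of_isScalarTower hsep.isIntegral)
  have hc : c = 0 := hT c (by
    rwa [hs'c, map_add, hvalue, add_eq_left, artinSchreierSum_algebraMap_comp] at hvalue')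
  exact hne (by rw [hs'c, hc, map_zero, add_zero])

end Field

section Conjugates

/-- The elements of `F` by which the conjugates of `s` over `K` differ from `s`. -/
def conjTranslations (F K : Type*) {M : Type*} [Field F] [Field K] [Field M] [Algebra F K]
    [Algebra F M] [Algebra K M] [IsScalarTower F K M] (s : M) : AddSubgroup F where
  carrier := {c | IsConjRoot K s (s + algebraMap F M c)}
  zero_mem' := by simpa using IsConjRoot.refl
  add_mem' := by
    intro a b ha hb
    refine hb.trans ?_
    have hab := IsConjRoot.add_algebraMap (algebraMap F K b) ha
    rw [← IsScalarTower.algebraMap_apply] at hab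
    rwa [add_assoc, ← map_add] at hab
  neg_mem' := by
    intro a ha
    have hneg := IsConjRoot.add_algebraMap (algebraMap F K (-a)) ha.symm
    rwa [← IsScalarTower.algebraMap_apply, map_neg, add_neg_cancel_right, ← map_neg] at hneg

variable {K M : Type*} [Field K] [Field M] [Algebra K M] {n : ℕ} {x : K} {s : M}
  (F : Type*) [Field F] [Algebra F K] [Algebra F M] [IsScalarTower F K M]

theorem finite_conjTranslations_and_card_le (hs : IsIntegral K s) :
    Finite (conjTranslations F K s) ∧
      Nat.card (conjTranslations F K s) ≤ (minpoly K s).natDegree := by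
  have hmaps : Set.MapsTo (fun c ↦ s + algebraMap F M c) (conjTranslations F K s : Set F)
      ((minpoly K s).rootSet M) := fun c hc ↦
    (isConjRoot_iff_mem_minpoly_rootSet hs).mp hc
  have hinj : Set.InjOn (fun c ↦ s + algebraMap F M c) (conjTranslations F K s : Set F) :=
    ((add_right_injective s).comp (algebraMap F M).injective).injOn
  have hfin := (minpoly K s).rootSet_finite M
  exact ⟨Set.Finite.of_injOn hmaps hinj hfin,
    (Set.ncard_le_ncard_of_injOn _ hmaps hinj hfin).trans ((minpoly K s).ncard_rootSet_le M)⟩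

variable [CharP K p] [CharP M p] [IsAlgClosed F] [CharP F p]
variable {p}

/-- If `s` had too few conjugates, they would differ from `s` by a group of elements of `F` killed
by some `∑ c l • ℘ˡ`, so that `∑ c l • ℘ˡ s` would be fixed under conjugation. -/
theorem pow_le_natDegree_minpoly_of_artinSchreier_iterate_eq
    (hs : (artinSchreier p M)^[n] s = algebraMap K M x)
    (hindep : ∀ c : ℕ → F, artinSchreierSum p n c s ∈ Set.range (algebraMap K M) →
      ∀ l < n, c l = 0) :
    p ^ n ≤ (minpoly K s).natDegree := by
  have hsep := isSeparable_of_artinSchreier_iterate_eq hs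
  obtain ⟨_, hcard⟩ := finite_conjTranslations_and_card_le F hsep.isIntegral
  refine le_trans ?_ hcard
  by_contra! hlt
  obtain ⟨c, ⟨l, hl, hcl⟩, hc⟩ := exists_artinSchreierSum_eq_zero p _ hlt
  refine hcl (hindep c ?_ l hl)
  set r : M := artinSchreierSum p n (algebraMap F K ∘ c) s with hr
  have hunique (r' : M) (hr' : IsConjRoot K r r') : r = r' := by
    obtain ⟨a, ha, rfl⟩ := exists_eq_artinSchreierSum_of_isConjRoot F hs n _ hr'
    have hkill := map_artinSchreierSum p (Algebra.ofId F M) n c a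
    rw [hc a ha, map_zero, Algebra.ofId_apply] at hkill
    rw [map_add, artinSchreierSum_algebraMap_comp p n c (algebraMap F M a), ← hkill, add_zero]
  rw [← artinSchreierSum_algebraMap_comp p (R := K), ← hr]
  by_contra hrange
  obtain ⟨r', hne, hr'⟩ := (notMem_iff_exists_ne_and_isConjRoot
    (isSeparable_artinSchreierSum hs n _) (splits_minpoly_artinSchreierSum F hs n _)).mp hrange
  exact hne (hunique r' hr')

end Conjugates
end ArtinSchreier

section Norm

/-- The order-reversing map `q ↦ 2 ^ (-q)`, `∞ ↦ 0` which turns an additive valuation with values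
in `ℚ ∪ {∞}` into an absolute value. -/
def expNeg (q : WithTop ℚ) : ℝ := q.recTopCoe 0 fun r ↦ 2 ^ (-(r : ℝ))

theorem expNeg_top : expNeg ⊤ = 0 := rfl

theorem expNeg_coe (q : ℚ) : expNeg q = 2 ^ (-(q : ℝ)) := rfl

theorem expNeg_strictAnti : StrictAnti expNeg := by
  intro q r hqr
  induction r with
  | top =>
    lift q to ℚ using hqr.ne
    exact Real.rpow_pos_of_pos two_pos _
  | coe r =>
    lift q to ℚ using (hqr.trans (WithTop.coe_lt_top r)).ne
    exact Real.rpow_lt_rpow_of_exponent_lt one_lt_two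
      (neg_lt_neg (Rat.cast_lt.mpr (WithTop.coe_lt_coe.mp hqr)))

theorem expNeg_nonneg (q : WithTop ℚ) : 0 ≤ expNeg q :=
  expNeg_strictAnti.antitone (le_top : q ≤ ⊤)

theorem expNeg_add (q r : WithTop ℚ) : expNeg (q + r) = expNeg q * expNeg r := by
  induction q with
  | top => rw [WithTop.top_add, expNeg_top, zero_mul]
  | coe q =>
    induction r with
    | top => rw [WithTop.add_top, expNeg_top, mul_zero]
    | coe r =>
      rw [← WithTop.coe_add, expNeg_coe, expNeg_coe, expNeg_coe, Rat.cast_add, neg_add,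
        Real.rpow_add two_pos]

variable {F : Type*} [Field F]

theorem expNeg_v_add_le_max (x y : Hahn F) :
    expNeg (v F (x + y)) ≤ max (expNeg (v F x)) (expNeg (v F y)) := by
  rw [← expNeg_strictAnti.antitone.map_min]
  exact expNeg_strictAnti.antitone ((v F).map_add x y)

/-- The absolute value `2 ^ (-v x)` on the Hahn field. -/
def absHahn (F : Type*) [Field F] : AbsoluteValue (Hahn F) ℝ where
  toFun x := expNeg (v F x)
  map_mul' x y := by rw [(v F).map_mul, expNeg_add]
  nonneg' x := expNeg_nonneg _
  eq_zero' x := by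
    rw [← expNeg_top, expNeg_strictAnti.injective.eq_iff, (v F).top_iff]
  add_le' x y := (expNeg_v_add_le_max x y).trans
    (max_le_add_of_nonneg (expNeg_nonneg _) (expNeg_nonneg _))

instance : NormedField (Hahn F) := (absHahn F).toNormedField

theorem norm_eq_expNeg (x : Hahn F) : ‖x‖ = expNeg (v F x) := rfl

instance : IsUltrametricDist (Hahn F) :=
  IsUltrametricDist.isUltrametricDist_of_forall_norm_add_le_max_norm expNeg_v_add_le_max

theorem norm_lt_norm_iff {x y : Hahn F} : ‖x‖ < ‖y‖ ↔ v F y < v F x :=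
  expNeg_strictAnti.lt_iff_gt

theorem norm_le_expNeg_iff {x : Hahn F} {q : ℚ} :
    ‖x‖ ≤ expNeg q ↔ ∀ r < q, x.coeff r = 0 := by
  rw [norm_eq_expNeg, expNeg_strictAnti.le_iff_ge, HahnSeries.addVal_apply,
    HahnSeries.le_orderTop_iff_forall]
  simp

theorem expNeg_natCast (n : ℕ) : expNeg (n : ℚ) = 2⁻¹ ^ n := by
  rw [expNeg_coe, Rat.cast_natCast, Real.rpow_neg two_pos.le, Real.rpow_natCast, inv_pow]

end Norm

section Complete

variable {F : Type*} [Field F]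

theorem isPWO_of_forall_inter_Iic {s : Set ℚ} (h : ∀ q, (s ∩ Set.Iic q).IsPWO) : s.IsPWO := by
  rw [Set.isPWO_iff_isWF, Set.isWF_iff_no_descending_seq]
  intro f hf hmem
  exact Set.isWF_iff_no_descending_seq.mp (h (f 0)).isWF f hf fun n ↦
    ⟨hmem n, hf.antitone n.zero_le⟩

/-- The limit of `u`, if for every `q` the coefficients of `u n` at exponents `≤ q` do not depend
on `n ≥ q`. -/
def limitOfStableCoeff (u : ℕ → Hahn F)
    (hu : ∀ (n : ℕ) (q : ℚ), q ≤ n → (u n).coeff q = (u ⌈q⌉₊).coeff q) : Hahn F where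
  coeff q := (u ⌈q⌉₊).coeff q
  isPWO_support' := isPWO_of_forall_inter_Iic fun q ↦
    (u ⌈q⌉₊).isPWO_support.mono fun r ⟨hr, hrq⟩ ↦ by
      rwa [HahnSeries.mem_support, hu ⌈q⌉₊ r (le_trans hrq (Nat.le_ceil q))]

instance : CompleteSpace (Hahn F) := by
  refine Metric.complete_of_convergent_controlled_sequences (fun n ↦ 2⁻¹ ^ (n + 1))
    (fun n ↦ by positivity) fun u hu ↦ ?_
  have hstable (n : ℕ) (q : ℚ) (hq : q ≤ n) : (u n).coeff q = (u ⌈q⌉₊).coeff q := by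
    have hdist := (hu ⌈q⌉₊ n ⌈q⌉₊ (Nat.ceil_le.mpr hq) le_rfl).le
    rw [dist_eq_norm, ← expNeg_natCast, norm_le_expNeg_iff] at hdist
    have hlt : q < (⌈q⌉₊ + 1 : ℕ) := by
      rw [Nat.cast_add, Nat.cast_one]
      exact (Nat.le_ceil q).trans_lt (lt_add_one _)
    rw [← sub_eq_zero, ← HahnSeries.coeff_sub, hdist q hlt]
  refine ⟨limitOfStableCoeff u hstable, tendsto_iff_dist_tendsto_zero.mpr ?_⟩
  refine squeeze_zero (fun _ ↦ dist_nonneg) (fun n ↦ ?_)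
    (tendsto_pow_atTop_nhds_zero_of_lt_one (r := (2⁻¹ : ℝ)) (by norm_num) (by norm_num))
  rw [dist_eq_norm, ← expNeg_natCast, norm_le_expNeg_iff]
  intro q hq
  rw [HahnSeries.coeff_sub, hstable n q hq.le, sub_eq_zero]
  rfl

theorem isClosed_setOf_coeff_eq_zero (q : ℚ) : IsClosed {x : Hahn F | x.coeff q = 0} := by
  refine isClosed_of_closure_subset fun x hx ↦ ?_
  obtain ⟨y, hy, hxy⟩ := Metric.mem_closure_iff.mp hx (expNeg (q + 1 : ℚ))
    (Real.rpow_pos_of_pos two_pos _)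
  rw [dist_eq_norm] at hxy
  have hcoeff := norm_le_expNeg_iff.mp hxy.le q (lt_add_one q)
  rwa [HahnSeries.coeff_sub, hy, sub_zero] at hcoeff

theorem isClosed_fieldRange_ramify (N : ℕ+) :
    IsClosed ((ramify F N).fieldRange : Set (Hahn F)) := by
  have hInter : ((ramify F N).fieldRange : Set (Hahn F)) =
      ⋂ q ∈ {q : ℚ | ¬ ∃ k : ℤ, q = k * (N : ℚ)⁻¹}, {x : Hahn F | x.coeff q = 0} := by
    ext x
    simp only [SetLike.mem_coe, mem_range_ramify, HahnSeries.mem_support, Set.mem_iInter]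
    exact forall_congr' fun q ↦ not_imp_comm
  rw [hInter]
  exact isClosed_biInter fun q _ ↦ isClosed_setOf_coeff_eq_zero q

instance (N : ℕ+) : CompleteSpace (ramify F N).fieldRange :=
  (isClosed_fieldRange_ramify N).completeSpace_coe

end Complete

section Puiseux

variable {F : Type*} [Field F]

theorem directed_fieldRange_ramify :
    Directed (· ≤ ·) fun N : ℕ+ ↦ (ramify F N).fieldRange := fun N M ↦
  ⟨N * M, range_ramify_le (by simp), range_ramify_le (by simp)⟩

theorem puiseux_eq_iSup : puiseux F = ⨆ N, (ramify F N).fieldRange := by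
  ext x
  rw [Subfield.mem_iSup_of_directed directed_fieldRange_ramify]
  rfl

theorem single_mem_fieldRange_ramify (N : ℕ+) (k : ℤ) (a : F) :
    (HahnSeries.single (k : ℚ) a : Hahn F) ∈ (ramify F N).fieldRange := by
  rw [mem_range_ramify]
  intro q hq
  refine ⟨k * N, ?_⟩
  rw [HahnSeries.support_single_subset hq, Int.cast_mul, Int.cast_natCast,
    mul_inv_cancel_right₀ (by exact_mod_cast N.ne_zero)]

theorem exists_one_lt_norm_fieldRange_ramify (N : ℕ+) :
    ∃ x : (ramify F N).fieldRange, 1 < ‖x‖ := by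
  refine ⟨⟨_, single_mem_fieldRange_ramify N (-1) 1⟩, ?_⟩
  have hv : v F (HahnSeries.single ((-1 : ℤ) : ℚ) 1) < v F 1 := by
    rw [(v F).map_one, HahnSeries.addVal_apply, HahnSeries.orderTop_single one_ne_zero]
    norm_cast
  rw [← norm_one (α := Hahn F)]
  exact norm_lt_norm_iff.mpr hv

end Puiseux

section Frobenius

open HahnSeries
open scoped Pointwise

variable {Γ R : Type*} [AddCommMonoid Γ] [LinearOrder Γ] [IsOrderedCancelAddMonoid Γ]

theorem support_pow_subset [Semiring R] (x : HahnSeries Γ R) (k : ℕ) :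
    (x ^ k).support ⊆ k • x.support := by
  induction k with
  | zero =>
    rw [pow_zero, zero_nsmul]
    exact support_single_subset
  | succ k ih =>
    rw [pow_succ, succ_nsmul]
    exact support_mul_subset.trans (Set.add_subset_add_right ih)

theorem nsmul_Iio_subset (r : Γ) {k : ℕ} (hk : k ≠ 0) :
    k • Set.Iio r ⊆ Set.Iio (k • r) := by
  induction k, Nat.one_le_iff_ne_zero.mpr hk using Nat.le_induction with
  | base => simp only [one_nsmul, subset_rfl]
  | succ k hk1 ih =>
    rw [succ_nsmul, succ_nsmul]
    exact Set.add_subset_iff.mpr fun a ha b hb ↦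
      add_lt_add (ih (Nat.one_le_iff_ne_zero.mp hk1) ha) hb

theorem nsmul_Ioi_subset (r : Γ) {k : ℕ} (hk : k ≠ 0) :
    k • Set.Ioi r ⊆ Set.Ioi (k • r) :=
  nsmul_Iio_subset (Γ := Γᵒᵈ) r hk

variable [CommRing R] (p : ℕ) [hp : Fact p.Prime] [CharP R p]

instance charP_hahnSeries : CharP (HahnSeries Γ R) p :=
  charP_of_injective_ringHom (C_injective (Γ := Γ) (R := R)) p

theorem coeff_pow_char (x : HahnSeries Γ R) (r : Γ) :
    (x ^ p).coeff (p • r) = x.coeff r ^ p := by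
  set below := truncLT r x with hbelow
  set above := x - below - single r (x.coeff r) with habove
  have hx : x = below + single r (x.coeff r) + above := by rw [habove]; ring
  have hcoeff_below : (below ^ p).coeff (p • r) = 0 := by
    by_contra hne
    have hsupport : below.support ⊆ Set.Iio r := by
      rw [hbelow, support_truncLT]
      exact Set.inter_subset_right
    exact (nsmul_Iio_subset r hp.out.ne_zero
      (Set.nsmul_subset_nsmul_left hsupport (support_pow_subset below p hne))).false
  have hcoeff_above : (above ^ p).coeff (p • r) = 0 := by
    by_contra hne
    have hsupport : above.support ⊆ Set.Ioi r := fun q hq ↦ by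
      by_contra hle
      refine hq ?_
      rcases (not_lt.mp hle).lt_or_eq with hlt | rfl
      · simp [habove, hbelow, coeff_truncLT_of_lt hlt, coeff_single_of_ne hlt.ne]
      · simp [habove, hbelow, coeff_truncLT_of_le le_rfl]
    exact (nsmul_Ioi_subset r hp.out.ne_zero
      (Set.nsmul_subset_nsmul_left hsupport (support_pow_subset above p hne))).false
  conv_lhs => rw [hx]
  rw [add_pow_char, add_pow_char, coeff_add, coeff_add, hcoeff_below, hcoeff_above, single_pow,
    coeff_single_same, zero_add, add_zero]

end Frobenius

section Tower

open HahnSeries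

variable (p : ℕ) [hp : Fact p.Prime] (F : Type*) [Field F]

theorem coeff_shift_layer (n m j : ℕ) :
    (single (n : ℚ) (1 : F) * layer p F n).coeff (delta p m j) =
      if m = n then (j.choose n : F) else 0 := by
  have hexponent (i : ℕ) : delta p m j - n = -1 / (p : ℚ) ^ (i + 1) ↔ m = n ∧ j = i := by
    constructor
    · intro h
      refine delta_eq_imp p ?_
      simp only [delta] at h ⊢
      linear_combination h
    · rintro ⟨rfl, rfl⟩
      simp only [delta]
      ring
  have hterm (i : ℕ) : (layerFamily p F n i).coeff (delta p m j - n) =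
      if m = n ∧ j = i then (i.choose n : F) else 0 := by
    change (single (-1 / (p : ℚ) ^ (i + 1)) (i.choose n : F)).coeff _ = _
    rw [coeff_single]
    simp only [hexponent]
  rw [coeff_single_mul, one_mul, layer, SummableFamily.coeff_hsum, finsum_eq_single _ j, hterm]
  · simp only [and_true]
  · intro i hi
    rw [hterm, if_neg (fun h ↦ hi h.2.symm)]

theorem coeff_layer (n j : ℕ) : (layer p F n).coeff (-1 / (p : ℚ) ^ (j + 1)) = j.choose n := by
  have h := coeff_shift_layer p F n n j
  rw [if_pos rfl, coeff_single_mul, one_mul] at h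
  rw [← h]
  congr 1
  simp only [delta]
  ring

theorem exists_of_coeff_layer_ne_zero {n : ℕ} {q : ℚ} (h : (layer p F n).coeff q ≠ 0) :
    ∃ j : ℕ, q = -1 / (p : ℚ) ^ (j + 1) := by
  obtain ⟨j, hj⟩ := support_shift_layer p F n (q := q + n) (by
    rwa [coeff_single_mul, one_mul, add_sub_cancel_right])
  refine ⟨j, ?_⟩
  simp only [delta] at hj
  linear_combination hj

/-- The tower `t ^ (-1), s_0, s_1, …`, each member of which is the image of the next one under the
Artin–Schreier map. -/
def tower : ℕ → Hahn F
  | 0 => single (-1) 1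
  | m + 1 => layer p F m

theorem exists_of_coeff_tower_ne_zero {n : ℕ} {q : ℚ} (h : (tower p F n).coeff q ≠ 0) :
    ∃ j : ℕ, q = -1 / (p : ℚ) ^ j := by
  cases n with
  | zero => exact ⟨0, by simpa using support_single_subset h⟩
  | succ n =>
    obtain ⟨j, hj⟩ := exists_of_coeff_layer_ne_zero p F h
    exact ⟨j + 1, hj⟩

theorem neg_one_div_pow_succ_ne_neg_one (j : ℕ) : -1 / (p : ℚ) ^ (j + 1) ≠ -1 := by
  have hlt : (1 : ℚ) < (p : ℚ) ^ (j + 1) :=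
    one_lt_pow₀ (by exact_mod_cast hp.out.one_lt) j.succ_ne_zero
  intro h
  rw [div_eq_iff (by positivity)] at h
  linarith

theorem coeff_layer_neg_one (n : ℕ) : (layer p F n).coeff (-1) = 0 := by
  by_contra hne
  obtain ⟨j, hj⟩ := exists_of_coeff_layer_ne_zero p F hne
  exact neg_one_div_pow_succ_ne_neg_one p j hj.symm

variable [CharP F p]

/-- On the coefficients of `t ^ (-1 / p ^ j)` this is Pascal's rule. -/
theorem artinSchreier_tower_succ (n : ℕ) :
    artinSchreier p (Hahn F) (tower p F (n + 1)) = tower p F n := by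
  have hp0 : (p : ℚ) ≠ 0 := by exact_mod_cast hp.out.ne_zero
  ext q
  obtain ⟨r, rfl⟩ : ∃ r : ℚ, q = p • r := ⟨q / p, by rw [nsmul_eq_mul, mul_div_cancel₀ _ hp0]⟩
  have hscale (j : ℕ) : p • r = -1 / (p : ℚ) ^ j ↔ r = -1 / (p : ℚ) ^ (j + 1) := by
    rw [nsmul_eq_mul, pow_succ, ← div_div, eq_div_iff hp0, mul_comm]
  rw [artinSchreier_apply, coeff_sub, coeff_pow_char]
  by_cases hr : ∃ j : ℕ, r = -1 / (p : ℚ) ^ (j + 1)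
  · obtain ⟨j, hj⟩ := hr
    rw [(hscale j).mpr hj, hj, tower, coeff_layer, ← frobenius_def, map_natCast]
    cases j with
    | zero =>
      rw [pow_zero, div_one, coeff_layer_neg_one]
      cases n with
      | zero => simp [tower]
      | succ n => simp [tower, coeff_layer_neg_one]
    | succ j =>
      rw [coeff_layer]
      cases n with
      | zero => simp [tower, coeff_single_of_ne (neg_one_div_pow_succ_ne_neg_one p j)]
      | succ n =>
        rw [tower, coeff_layer, Nat.choose_succ_succ, Nat.cast_add, add_sub_cancel_right]
  · have htower (m : ℕ) : (tower p F m).coeff (p • r) = 0 := by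
      by_contra hne
      obtain ⟨j, hj⟩ := exists_of_coeff_tower_ne_zero p F hne
      exact hr ⟨j, (hscale j).mp hj⟩
    have hlayer : (layer p F n).coeff r = 0 := by
      by_contra hne
      exact hr (exists_of_coeff_layer_ne_zero p F hne)
    rw [htower, htower, tower, hlayer, zero_pow hp.out.ne_zero, sub_zero]

theorem artinSchreier_iterate_tower (n l : ℕ) :
    (artinSchreier p (Hahn F))^[l] (tower p F (n + l)) = tower p F n := by
  induction l with
  | zero => rfl
  | succ l ih => rw [Function.iterate_succ_apply, ← add_assoc, artinSchreier_tower_succ, ih]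

theorem artinSchreierSum_tower {R : Type*} [CommRing R] [Algebra R (Hahn F)] (n : ℕ) (T : ℕ → R) :
    artinSchreierSum p n T (tower p F n) =
      ∑ m ∈ Finset.range n, T (n - 1 - m) • layer p F m := by
  rw [artinSchreierSum_apply, ← Finset.sum_range_reflect]
  refine Finset.sum_congr rfl fun m hm ↦ ?_
  have hn : n = m + 1 + (n - 1 - m) := by have := Finset.mem_range.mp hm; lia
  nth_rewrite 3 [hn]
  rw [artinSchreier_iterate_tower, tower]

end Tower

section PartialSum

open HahnSeries

variable (p : ℕ) [hp : Fact p.Prime] (F : Type*) [Field F]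

theorem coeff_series (n j : ℕ) : (series p F).coeff (delta p n j) = j.choose n := by
  rw [series, SummableFamily.coeff_hsum, finsum_eq_single _ n]
  · exact (coeff_shift_layer p F n n j).trans (if_pos rfl)
  · intro m hm
    exact (coeff_shift_layer p F m n j).trans (if_neg hm.symm)

theorem exists_of_coeff_series_ne_zero {q : ℚ} (h : (series p F).coeff q ≠ 0) :
    ∃ n j : ℕ, q = delta p n j := by
  rw [series, SummableFamily.coeff_hsum] at h
  obtain ⟨n, hn⟩ := not_forall.mp (mt finsum_eq_zero_of_forall_eq_zero h)
  exact ⟨n, support_shift_layer p F n hn⟩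

/-- The partial sum `∑_{m < n} t ^ m s_m` of the series `s`. -/
def partialSum (n : ℕ) : Hahn F :=
  ∑ m ∈ Finset.range n, single (m : ℚ) (1 : F) * layer p F m

theorem coeff_partialSum (n m j : ℕ) :
    (partialSum p F n).coeff (delta p m j) = if m < n then (j.choose m : F) else 0 := by
  rw [partialSum, coeff_sum]
  simp only [coeff_shift_layer, Finset.sum_ite_eq, Finset.mem_range]

theorem exists_of_coeff_partialSum_ne_zero {n : ℕ} {q : ℚ} (h : (partialSum p F n).coeff q ≠ 0) :
    ∃ m j : ℕ, q = delta p m j := by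
  rw [partialSum, coeff_sum] at h
  obtain ⟨m, -, hm⟩ := Finset.exists_ne_zero_of_sum_ne_zero h
  exact ⟨m, support_shift_layer p F m hm⟩

theorem exists_of_coeff_trunc_sub_ne_zero {n i : ℕ} {q : ℚ}
    (h : (trunc p F n i - partialSum p F n).coeff q ≠ 0) :
    ∃ j < i, q = delta p n j := by
  obtain ⟨m, j, rfl⟩ : ∃ m j : ℕ, q = delta p m j := by
    by_cases hpartial : (partialSum p F n).coeff q = 0
    · refine exists_of_coeff_series_ne_zero p F fun hseries ↦ h ?_
      rw [coeff_sub, hpartial, trunc, HahnSeries.coeff_truncLT, hseries, ite_self, sub_zero]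
    · exact exists_of_coeff_partialSum_ne_zero p F hpartial
  rw [coeff_sub, trunc, HahnSeries.coeff_truncLT, coeff_series, coeff_partialSum] at h
  obtain ⟨hm_lt, hlt_m⟩ := delta_bounds p m j
  obtain ⟨hn_lt, hlt_n⟩ := delta_bounds p n i
  rcases lt_trichotomy m n with hmn | rfl | hmn
  · have hmn' : (m : ℚ) + 1 ≤ n := by exact_mod_cast hmn
    rw [if_pos (by linarith), if_pos hmn, sub_self] at h
    exact absurd rfl h
  · refine ⟨j, ?_, rfl⟩
    by_contra! hij
    rw [if_neg (not_lt.mpr ((delta_strictMono p m).monotone hij)), if_neg (lt_irrefl m),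
      sub_self] at h
    exact h rfl
  · have hmn' : (n : ℚ) + 1 ≤ m := by exact_mod_cast hmn
    rw [if_neg (by linarith), if_neg hmn.not_gt, sub_self] at h
    exact absurd rfl h

theorem trunc_sub_partialSum_mem_puiseux (n i : ℕ) :
    trunc p F n i - partialSum p F n ∈ puiseux F := by
  have hp0 : (p : ℚ) ≠ 0 := by exact_mod_cast hp.out.ne_zero
  refine ⟨⟨p ^ i, pow_pos hp.out.pos i⟩, (mem_range_ramify _ _).mpr fun q hq ↦ ?_⟩
  obtain ⟨j, hj, rfl⟩ := exists_of_coeff_trunc_sub_ne_zero p F hq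
  obtain ⟨d, rfl⟩ := Nat.exists_eq_add_of_le (Nat.succ_le_of_lt hj)
  refine ⟨n * p ^ (j + 1 + d) - p ^ d, ?_⟩
  simp only [delta, PNat.mk_coe]
  push_cast
  rw [Nat.succ_eq_add_one, pow_add _ (j + 1)]
  field_simp

theorem lt_v_sub_partialSum {n i : ℕ} {b : Hahn F}
    (hb : (delta p n i : WithTop ℚ) ≤ v F (b - trunc p F n i)) :
    ((n - 1 : ℚ) : WithTop ℚ) < v F (b - partialSum p F n) := by
  have hdelta (j : ℕ) : delta p n 0 ≤ delta p n j := (delta_strictMono p n).monotone j.zero_le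
  have htrunc : (delta p n 0 : WithTop ℚ) ≤ v F (trunc p F n i - partialSum p F n) := by
    rw [addVal_apply, le_orderTop_iff_forall]
    intro q hq
    by_contra hne
    obtain ⟨j, -, rfl⟩ := exists_of_coeff_trunc_sub_ne_zero p F hne
    exact (WithTop.coe_lt_coe.mp hq).not_ge (hdelta j)
  rw [← sub_add_sub_cancel b (trunc p F n i)]
  exact (WithTop.coe_lt_coe.mpr (delta_bounds p n 0).1).trans_le
    ((v F).map_le_add ((WithTop.coe_le_coe.mpr (hdelta i)).trans hb) htrunc)

end PartialSum

section MinimalPair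

open HahnSeries IntermediateField

theorem natDegree_minpoly_le_of_mem_adjoin {K L : Type*} [Field K] [Field L] [Algebra K L] {x y : L}
    (hx : IsIntegral K x) (hy : y ∈ K⟮x⟯) :
    (minpoly K y).natDegree ≤ (minpoly K x).natDegree := by
  have : FiniteDimensional K K⟮x⟯ := adjoin.finiteDimensional hx
  rw [← adjoin.finrank hx, ← minpoly_eq (⟨y, hy⟩ : K⟮x⟯)]
  exact minpoly.natDegree_le _

section Puiseux

variable {F : Type*} [Field F]

theorem single_mem_puiseux (k : ℤ) (a : F) : (single (k : ℚ) a : Hahn F) ∈ puiseux F :=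
  ⟨1, single_mem_fieldRange_ramify 1 k a⟩

theorem C_mem_puiseux (a : F) : (C a : Hahn F) ∈ puiseux F := by
  have h := single_mem_puiseux 0 a
  rwa [Int.cast_zero] at h

/- Instance resolution would otherwise pick the power series algebra structure, which agrees with
this one only propositionally. -/
instance algebraHahn : Algebra F (Hahn F) :=
  HahnSeries.instAlgebra

instance algebraPuiseux : Algebra F (puiseux F) :=
  ((C : F →+* Hahn F).codRestrict (puiseux F) C_mem_puiseux).toAlgebra

instance isScalarTower_puiseux : IsScalarTower F (puiseux F) (Hahn F) :=
  IsScalarTower.of_algebraMap_eq fun _ ↦ rfl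

instance charP_puiseux (p : ℕ) [CharP F p] : CharP (puiseux F) p :=
  (RingHom.charP_iff (puiseux F).subtype Subtype.val_injective p).mpr inferInstance

/-- The monomial `t ^ k` as an element of the Newton–Puiseux field. -/
def puiseuxMonomial (F : Type*) [Field F] (k : ℕ) : puiseux F :=
  ⟨_, single_mem_puiseux k 1⟩

theorem puiseuxMonomial_smul (k : ℕ) (x : Hahn F) :
    puiseuxMonomial F k • x = single (k : ℚ) (1 : F) * x := by
  change single ((k : ℤ) : ℚ) (1 : F) * x = _
  rw [Int.cast_natCast]

theorem degK_eq (a : Kbar F) : degK a = (minpoly (puiseux F) (a : Hahn F)).natDegree :=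
  congrArg _ (minpoly.algebraMap_eq (algebraMap (Kbar F) (Hahn F)).injective a).symm

end Puiseux

theorem eq_zero_of_sum_choose_eq_zero {R : Type*} [CommRing R] {N n : ℕ} {c : ℕ → R}
    (h : ∀ j ≥ N, ∑ m ∈ Finset.range n, c m * (j.choose m : R) = 0) :
    ∀ m < n, c m = 0 := by
  induction n generalizing c with
  | zero => simp
  | succ n ih =>
    have hsucc : ∀ m < n, c (m + 1) = 0 := by
      refine ih (c := fun m ↦ c (m + 1)) fun j hj ↦ ?_
      have hj0 := h j hj
      have hj1 := h (j + 1) (by lia)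
      rw [Finset.sum_range_succ'] at hj0 hj1
      simp only [Nat.choose_succ_succ, Nat.cast_add, mul_add, Finset.sum_add_distrib] at hj1
      simp only [Nat.choose_zero_right] at hj0 hj1
      linear_combination hj1 - hj0
    intro m hm
    cases m with
    | succ m => exact hsucc m (by lia)
    | zero =>
      have hN := h N le_rfl
      rw [Finset.sum_range_succ', Finset.sum_eq_zero fun m hm ↦ by
        rw [hsucc m (Finset.mem_range.mp hm), zero_mul]] at hN
      simpa using hN

theorem coeff_neg_one_div_pow_eq_zero_of_mem_fieldRange_ramify {p : ℕ} (hp : 1 < p) {F : Type*}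
    [Field F] {N : ℕ+} {x : Hahn F} (hx : x ∈ (ramify F N).fieldRange) {j : ℕ} (hj : N ≤ j) :
    x.coeff (-1 / (p : ℚ) ^ j) = 0 := by
  by_contra hne
  obtain ⟨k, hk⟩ := (mem_range_ramify N x).mp hx _ hne
  have hN : (N : ℤ) = -k * (p : ℤ) ^ j := by
    field_simp at hk
    have : (N : ℚ) = -k * (p : ℚ) ^ j := by linear_combination -hk
    exact_mod_cast this
  have hdvd : p ^ j ∣ N := by
    rw [← Int.natCast_dvd_natCast, hN, Nat.cast_pow]
    exact dvd_mul_left _ _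
  exact (Nat.lt_pow_self hp).not_ge ((Nat.le_of_dvd N.pos hdvd).trans hj)

variable (p : ℕ) [hp : Fact p.Prime] (F : Type*) [Field F]

theorem eq_zero_of_sum_smul_layer_mem_puiseux {n : ℕ} {c : ℕ → F}
    (h : ∑ m ∈ Finset.range n, c m • layer p F m ∈ puiseux F) : ∀ m < n, c m = 0 := by
  obtain ⟨N, hN⟩ := h
  refine eq_zero_of_sum_choose_eq_zero (N := N) fun j hj ↦ ?_
  have hcoeff := coeff_neg_one_div_pow_eq_zero_of_mem_fieldRange_ramify hp.out.one_lt hN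
    (j := j + 1) (by lia)
  simpa only [coeff_sum, coeff_smul, coeff_layer, smul_eq_mul] using hcoeff

variable [CharP F p]

theorem artinSchreier_iterate_tower_self (n : ℕ) :
    (artinSchreier p (Hahn F))^[n] (tower p F n) =
      algebraMap (puiseux F) (Hahn F) ⟨_, single_mem_puiseux (-1) 1⟩ := by
  have h := artinSchreier_iterate_tower p F 0 n
  rw [zero_add] at h
  rw [h, tower]
  change _ = single ((-1 : ℤ) : ℚ) (1 : F)
  rw [Int.cast_neg, Int.cast_one]

theorem isIntegral_tower (n : ℕ) : IsIntegral (puiseux F) (tower p F n) :=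
  (isSeparable_of_artinSchreier_iterate_eq (artinSchreier_iterate_tower_self p F n)).isIntegral

theorem partialSum_eq_artinSchreierSum (n : ℕ) :
    partialSum p F n =
      artinSchreierSum p n (fun l ↦ puiseuxMonomial F (n - 1 - l)) (tower p F n) := by
  rw [artinSchreierSum_tower, partialSum]
  refine Finset.sum_congr rfl fun m hm ↦ ?_
  rw [puiseuxMonomial_smul, Nat.sub_sub_self (Nat.le_sub_one_of_lt (Finset.mem_range.mp hm))]

theorem trunc_mem_adjoin_tower (n i : ℕ) : trunc p F n i ∈ (puiseux F)⟮tower p F n⟯ := by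
  rw [← sub_add_cancel (trunc p F n i) (partialSum p F n), partialSum_eq_artinSchreierSum]
  refine add_mem ?_ (artinSchreierSum_mem p _ n _ (mem_adjoin_simple_self _ _))
  rw [← partialSum_eq_artinSchreierSum]
  exact IntermediateField.algebraMap_mem _
    (⟨_, trunc_sub_partialSum_mem_puiseux p F n i⟩ : puiseux F)

theorem trunc_mem_Kbar (n i : ℕ) : trunc p F n i ∈ Kbar F :=
  have := isAlgebraic_adjoin_simple (isIntegral_tower p F n)
  le_algebraicClosure _ _ _ (trunc_mem_adjoin_tower p F n i)

variable {F} in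
theorem coeff_artinSchreierSum_algebraMap {n : ℕ} (hn : n ≠ 0) (c : F) :
    (artinSchreierSum p n (fun l ↦ puiseuxMonomial F (n - 1 - l))
      (algebraMap F (Hahn F) c)).coeff (n - 1) = c := by
  have hn1 : (n - 1 : ℚ) = (n - 1 : ℕ) := (Nat.cast_pred (Nat.pos_of_ne_zero hn)).symm
  have hterm (l : ℕ) : puiseuxMonomial F (n - 1 - l) •
      (artinSchreier p (Hahn F))^[l] (algebraMap F (Hahn F) c) =
        single ((n - 1 - l : ℕ) : ℚ) ((artinSchreier p F)^[l] c) := by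
    rw [puiseuxMonomial_smul, ← map_artinSchreier_iterate, ← C_eq_algebraMap, C_apply,
      single_mul_single, add_zero, one_mul]
  rw [artinSchreierSum_apply, coeff_sum, hn1, Finset.sum_eq_single 0]
  · rw [hterm, Nat.sub_zero, coeff_single_same]
    rfl
  · intro l hl hl0
    rw [hterm, coeff_single_of_ne]
    have := Finset.mem_range.mp hl
    exact_mod_cast (by lia : n - 1 ≠ n - 1 - l)
  · exact fun h ↦ absurd (Finset.mem_range.mpr (Nat.pos_of_ne_zero hn)) h

variable [IsAlgClosed F]

theorem natDegree_minpoly_tower (n : ℕ) :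
    (minpoly (puiseux F) (tower p F n)).natDegree = p ^ n := by
  have hs := artinSchreier_iterate_tower_self p F n
  refine le_antisymm (natDegree_minpoly_le_of_artinSchreier_iterate_eq hs)
    (pow_le_natDegree_minpoly_of_artinSchreier_iterate_eq F hs fun c hc l hl ↦ ?_)
  rw [artinSchreierSum_tower] at hc
  obtain ⟨y, hy⟩ := hc
  have hmem : ∑ m ∈ Finset.range n, c (n - 1 - m) • layer p F m ∈ puiseux F := hy ▸ y.2
  have h := eq_zero_of_sum_smul_layer_mem_puiseux p F hmem (n - 1 - l) (by lia)
  rwa [Nat.sub_sub_self (Nat.le_sub_one_of_lt hl)] at h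

/-- A conjugate of the partial sum differs from it by an additive polynomial in some `c ≠ 0` with
leading term `c t ^ k`, so that Krasner's lemma applies to the ball. -/
theorem partialSum_mem_adjoin {n : ℕ} (hn : n ≠ 0) {b : Hahn F} (hb : IsIntegral (puiseux F) b)
    (hlt : ((n - 1 : ℚ) : WithTop ℚ) < v F (b - partialSum p F n)) :
    partialSum p F n ∈ (puiseux F)⟮b⟯ := by
  have hs := artinSchreier_iterate_tower_self p F n
  rw [partialSum_eq_artinSchreierSum] at hlt ⊢
  refine krasner_of_eq_iSup directed_fieldRange_ramify exists_one_lt_norm_fieldRange_ramify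
    puiseux_eq_iSup (isSeparable_artinSchreierSum hs _ _)
    (splits_minpoly_artinSchreierSum F hs _ _) hb fun a' ha' hne ↦ ?_
  obtain ⟨c, -, rfl⟩ := exists_eq_artinSchreierSum_of_isConjRoot F hs _ _ ha'
  rw [map_add, left_ne_add] at hne
  rw [map_add, norm_sub_rev, sub_add_cancel_left, norm_neg, norm_lt_norm_iff]
  refine lt_of_le_of_lt (orderTop_le_of_coeff_ne_zero ?_) hlt
  rw [coeff_artinSchreierSum_algebraMap p hn]
  rintro rfl
  rw [map_zero, map_zero] at hne
  exact hne rfl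

theorem tower_mem_adjoin_partialSum {n : ℕ} (hn : n ≠ 0) :
    tower p F n ∈ (puiseux F)⟮partialSum p F n⟯ := by
  rw [partialSum_eq_artinSchreierSum]
  refine mem_adjoin_artinSchreierSum F (artinSchreier_iterate_tower_self p F n) _ _ fun c hc ↦ ?_
  rw [← coeff_artinSchreierSum_algebraMap p hn c, hc, coeff_zero]

theorem pow_le_degK_of_mem_ball {n i : ℕ} (h : trunc p F n i ∈ Kbar F) {b : Kbar F}
    (hb : b ∈ ball (delta p n i) ⟨trunc p F n i, h⟩) : p ^ n ≤ degK b := by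
  have hbint : IsIntegral (puiseux F) (b : Hahn F) := (mem_algebraicClosure_iff.mp b.2).isIntegral
  rw [degK_eq]
  rcases eq_or_ne n 0 with rfl | hn
  · exact minpoly.natDegree_pos hbint
  · have htower : tower p F n ∈ (puiseux F)⟮(b : Hahn F)⟯ :=
      adjoin_simple_le_iff.mpr (partialSum_mem_adjoin p F hn hbint (lt_v_sub_partialSum p F hb))
        (tower_mem_adjoin_partialSum p F hn)
    exact natDegree_minpoly_tower p F n ▸ natDegree_minpoly_le_of_mem_adjoin hbint htower

theorem degK_trunc_le {n i : ℕ} (h : trunc p F n i ∈ Kbar F) :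
    degK ⟨trunc p F n i, h⟩ ≤ p ^ n := by
  rw [degK_eq, ← natDegree_minpoly_tower p F n]
  exact natDegree_minpoly_le_of_mem_adjoin (isIntegral_tower p F n) (trunc_mem_adjoin_tower p F n i)

end MinimalPair

end MinPair

end

open MinPair in
theorem mainTheorem5_general (p : ℕ) [Fact p.Prime] (F : Type*) [Field F] [IsAlgClosed F]
    [CharP F p] (n i : ℕ) :
    ∃ h : trunc p F n i ∈ Kbar F,
      IsMinimalPair ⟨trunc p F n i, h⟩ (delta p n i) ∧
      ballDegK (ball (delta p n i) ⟨trunc p F n i, h⟩) = p ^ n ∧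
      degK ⟨trunc p F n i, h⟩ = p ^ n := by
  have h := trunc_mem_Kbar p F n i
  have hmem : (⟨trunc p F n i, h⟩ : Kbar F) ∈ ball (delta p n i) ⟨trunc p F n i, h⟩ := by
    simp [ball]
  have hdeg : degK ⟨trunc p F n i, h⟩ = p ^ n :=
    le_antisymm (degK_trunc_le p F h) (pow_le_degK_of_mem_ball p F h hmem)
  have hball : ballDegK (ball (delta p n i) ⟨trunc p F n i, h⟩) = p ^ n := by
    refine le_antisymm (Nat.sInf_le ⟨_, hmem, hdeg⟩) (le_csInf ⟨_, _, hmem, rfl⟩ ?_)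
    rintro _ ⟨b, hb, rfl⟩
    exact pow_le_degK_of_mem_ball p F h hb
  exact ⟨h, hball.trans hdeg.symm, hball, hdeg⟩

theorem mainTheorem5 (p : ℕ) [Fact p.Prime] (F : Type*) [Field F] [Algebra (ZMod p) F]
    [IsAlgClosure (ZMod p) F] (n i : ℕ) (hni : (n, i) ∈ MinPair.S p) :
    ∃ h : MinPair.trunc p F n i ∈ MinPair.Kbar F,
      MinPair.IsMinimalPair ⟨MinPair.trunc p F n i, h⟩ (MinPair.delta p n i) ∧
      MinPair.ballDegK (MinPair.ball (MinPair.delta p n i) ⟨MinPair.trunc p F n i, h⟩) = p ^ n ∧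
      MinPair.degK ⟨MinPair.trunc p F n i, h⟩ = p ^ n := by
  have : CharP F p := charP_of_injective_algebraMap (algebraMap (ZMod p) F).injective p
  have : IsAlgClosed F := IsAlgClosure.isAlgClosed (ZMod p)
  exact mainTheorem5_general p F n i
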